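/- Let $\Lambda_n$ be the graph with vertex set $\mathbb{Z}^n$ in which two vertices are adjacent if and only if their Euclidean distance is $1$. For $t\ge 1$, a set $S$ of vertices of a graph $\Gamma$ is a $t$-perfect distance-dominating set ($t$-PDDS) in $\Gamma$ if for every vertex $v$ of $\Gamma$ there is a unique component $C_v$ of the induced subgraph $[S]$ with $d(v,C_v)\le t$, and in $C_v$ there is a unique vertex $w$ with $d(v,w)=d(v,C_v)$; here $d$ is the graph distance in $\Gamma$ and $d(v,C)=\min\{d(v,w) : w\in C\}$. For a finite graph $H$, a $t$-PDDS$[H]$ is a $t$-PDDS all of whose components are isomorphic to $H$. Let $P_k$ denote the path on $k$ vertices and $\square$ the Cartesian product of graphs. **Theorem.** A $t$-PDDS$[H]$ in $\Lambda_n$ exists in each of the following cases: (i) $t=1$, $n\ge 2$, and $H=P_k$ with $k\ge 1$; (ii) $t\ge 1$, $n=2$, and $H=P_k$ with $k\ge 1$; (iii) $t\ge 1$, $n=2$, and $H=P_2\square P_k$ with $k\ge 2$; (iv) $t=1$, $n=3r+2$ with $r\ge 0$, and $H=P_2\square P_2$; (v) $t=2$, $n=3$, and $H=P_2$. -/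

import Mathlib

namespace PDDS

/-- The graph `Λ_n`: its vertices are the points of `ℤ^n`, and two of them are adjacent when their
Euclidean distance (equivalently, the square of it) is `1`. -/
def Lam (n : ℕ) : SimpleGraph (Fin n → ℤ) where
  Adj u v := ∑ i, (u i - v i) ^ 2 = 1
  symm := ⟨fun u v h => by
    rw [← h]
    exact Finset.sum_congr rfl fun i _ => by ring⟩
  loopless := ⟨fun u h => by simp at h⟩

/-- The set of vertices, in the ambient graph, of a component `C` of the induced subgraph `[S]`. -/
def verts {V : Type*} {Γ : SimpleGraph V} {S : Set V} (C : (Γ.induce S).ConnectedComponent) :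
    Set V :=
  Subtype.val '' C.supp

/-- The distance in `Γ` from a vertex `v` to a set `C` of vertices. It is `⊤` if no vertex of `C`
can be reached from `v`; otherwise the infimum is a minimum. -/
noncomputable def distTo {V : Type*} (Γ : SimpleGraph V) (v : V) (C : Set V) : ℕ∞ :=
  ⨅ w ∈ C, Γ.edist v w

/-- `S` is a `t`-perfect distance-dominating set in `Γ`: for each vertex `v` there is a unique
component of `[S]` at distance at most `t` from `v`, and in that component there is a unique
vertex that realizes the distance. -/
def IsPDDS {V : Type*} (Γ : SimpleGraph V) (t : ℕ) (S : Set V) : Prop :=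
  ∀ v : V,
    (∃! C : (Γ.induce S).ConnectedComponent, distTo Γ v (verts C) ≤ t) ∧
    ∀ C : (Γ.induce S).ConnectedComponent, distTo Γ v (verts C) ≤ t →
      ∃! w : V, w ∈ verts C ∧ Γ.edist v w = distTo Γ v (verts C)

/-- `S` is a `t`-PDDS[`H`] in `Γ`: a `t`-PDDS all of whose components are isomorphic to `H`. -/
def IsPDDSOf {V W : Type*} (Γ : SimpleGraph V) (t : ℕ) (H : SimpleGraph W) (S : Set V) : Prop :=
  IsPDDS Γ t S ∧
    ∀ C : (Γ.induce S).ConnectedComponent, Nonempty (C.toSimpleGraph ≃g H)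

end PDDS

namespace PDDS

/-! Distance in `Λ_n` is `ℓ¹` distance, and the graphs `H` are realised as boxes. A box is gated:
clamping coordinates sends `v` to a point `p` of the box that lies on a shortest path from `v` to
each point of the box. So the nearest point is automatically unique, and `t ≥ 1` keeps distinct
translates non-adjacent. It therefore suffices to tile `ℤ^n` by translates of the `t`-neighbourhood
of a box (`isPDDSOf_of_tiling`, `exists_isPDDSOf_box`).

Every tiling is by a subgroup `L` of which the neighbourhood is a transversal
(`existsUnique_translate`). In (ii) and (iii), `L` is a planar lattice whose index is the size of
the neighbourhood (`path_tiling`, `two_box_tiling`). In (i) and (v) it is the kernel of a linear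
form modulo that size, chosen so that the neighbourhood meets each residue once (`path_tiling_one`,
`edge_tiling`). In (iv) two forms are used, modulo `12` and `2r + 1`, the size being `12(2r + 1)`
(`square_tiling`). -/

/-! ### The graph metric of `Λ_n`. -/

/-- The `ℓ¹` norm of an integer vector. -/
def l1 {n : ℕ} (x : Fin n → ℤ) : ℕ := ∑ i, (x i).natAbs

lemma l1_add_le {n : ℕ} (x y : Fin n → ℤ) : l1 (x + y) ≤ l1 x + l1 y := by
  unfold l1
  rw [← Finset.sum_add_distrib]
  exact Finset.sum_le_sum fun i _ => Int.natAbs_add_le _ _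

lemma l1_neg {n : ℕ} (x : Fin n → ℤ) : l1 (-x) = l1 x := by
  simp [l1]

lemma l1_eq_zero {n : ℕ} {x : Fin n → ℤ} : l1 x = 0 ↔ x = 0 := by
  simp [l1, funext_iff]

lemma natAbs_le_l1 {n : ℕ} (x : Fin n → ℤ) (i : Fin n) : (x i).natAbs ≤ l1 x :=
  Finset.single_le_sum (f := fun i => (x i).natAbs) (fun _ _ => Nat.zero_le _) (Finset.mem_univ i)

lemma l1_single {n : ℕ} (i : Fin n) (a : ℤ) : l1 (Pi.single i a) = a.natAbs := by
  unfold l1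
  rw [Finset.sum_eq_single i]
  · simp
  · intro j _ hj
    simp [hj]
  · simp

/-- If the squares or the absolute values sum to `1`, every entry is `0` or `±1`, and there `|a| =
a²`. -/
lemma lam_adj_iff {n : ℕ} {u v : Fin n → ℤ} : (Lam n).Adj u v ↔ l1 (u - v) = 1 := by
  have key : ∀ a : ℤ, a.natAbs ≤ 1 → (a.natAbs : ℤ) = a ^ 2 := by
    intro a ha
    have h : a = 0 ∨ a = 1 ∨ a = -1 := by omega
    rcases h with rfl | rfl | rfl <;> simp
  change ∑ i, (u i - v i) ^ 2 = 1 ↔ _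
  constructor
  · intro h
    have h1 : ∀ i, (u i - v i).natAbs ≤ 1 := by
      intro i
      have h2 : (u i - v i) ^ 2 ≤ ∑ i, (u i - v i) ^ 2 :=
        Finset.single_le_sum (f := fun i => (u i - v i) ^ 2) (fun _ _ => sq_nonneg _)
          (Finset.mem_univ i)
      rw [h] at h2
      have h3 := (sq_le_one_iff_abs_le_one _).1 h2
      rw [Int.abs_eq_natAbs] at h3
      omega
    zify [l1]
    rw [← h]
    exact Finset.sum_congr rfl fun i _ => by simpa using key _ (h1 i)
  · intro h
    have h1 : ∀ i, (u i - v i).natAbs ≤ 1 := fun i => h ▸ natAbs_le_l1 (u - v) i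
    have h2 : ((l1 (u - v) : ℕ) : ℤ) = 1 := by rw [h]; rfl
    rw [← h2]
    unfold l1
    push_cast
    exact Finset.sum_congr rfl fun i _ => by simpa using (key _ (h1 i)).symm

lemma l1_le_length {n : ℕ} {u v : Fin n → ℤ} (p : (Lam n).Walk u v) : l1 (u - v) ≤ p.length := by
  induction p with
  | nil => simp [l1]
  | @cons u v w h p ih =>
    have h1 := lam_adj_iff.1 h
    have h2 := l1_add_le (u - v) (v - w)
    rw [sub_add_sub_cancel] at h2
    simp only [SimpleGraph.Walk.length_cons]
    omega

lemma exists_walk_length_eq_l1 {n : ℕ} (m : ℕ) (u v : Fin n → ℤ) (h : l1 (u - v) = m) :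
    ∃ p : (Lam n).Walk u v, p.length = m := by
  induction m generalizing u with
  | zero =>
    have h1 := sub_eq_zero.1 (l1_eq_zero.1 h)
    subst h1
    exact ⟨.nil, rfl⟩
  | succ m ih =>
    have h1 : ∃ i, u i - v i ≠ 0 := by
      by_contra! hc
      have : u - v = 0 := funext hc
      rw [l1_eq_zero.2 this] at h
      omega
    obtain ⟨i, hi⟩ := h1
    have hs : (Int.sign (u i - v i)).natAbs = 1 := by
      rw [Int.natAbs_sign, if_neg hi]
    set w : Fin n → ℤ := u - Pi.single i (Int.sign (u i - v i)) with hw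
    have hwv : l1 (w - v) = m := by
      have e1 : l1 (u - v) = (u i - v i).natAbs + ∑ j ∈ Finset.univ.erase i, (u j - v j).natAbs :=
        (Finset.add_sum_erase _ (fun j => (u j - v j).natAbs) (Finset.mem_univ i)).symm
      have e2 : l1 (w - v) = (w i - v i).natAbs + ∑ j ∈ Finset.univ.erase i, (w j - v j).natAbs :=
        (Finset.add_sum_erase _ (fun j => (w j - v j).natAbs) (Finset.mem_univ i)).symm
      have e3 : ∑ j ∈ Finset.univ.erase i, (w j - v j).natAbs =
          ∑ j ∈ Finset.univ.erase i, (u j - v j).natAbs := by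
        refine Finset.sum_congr rfl fun j hj => ?_
        have : j ≠ i := Finset.ne_of_mem_erase hj
        simp [hw, this]
      have e4 : w i = u i - Int.sign (u i - v i) := by simp [hw]
      rw [e3] at e2
      have e5 : (w i - v i).natAbs + 1 = (u i - v i).natAbs := by
        rw [e4]
        rcases lt_or_gt_of_ne hi with h | h
        · rw [Int.sign_eq_neg_one_of_neg h]; omega
        · rw [Int.sign_eq_one_of_pos h]; omega
      omega
    obtain ⟨p, hp⟩ := ih w hwv
    have hadj : (Lam n).Adj u w := by
      rw [lam_adj_iff, hw, sub_sub_cancel, l1_single, hs]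
    exact ⟨.cons hadj p, by simp [hp]⟩

lemma lam_edist {n : ℕ} (u v : Fin n → ℤ) : (Lam n).edist u v = (l1 (u - v) : ℕ∞) := by
  obtain ⟨p, hp⟩ := exists_walk_length_eq_l1 _ u v rfl
  apply le_antisymm
  · rw [← hp]
    exact SimpleGraph.edist_le p
  · obtain ⟨q, hq⟩ := p.reachable.exists_walk_length_eq_edist
    rw [← hq]
    exact_mod_cast l1_le_length q

/-! ### From tilings to perfect distance-dominating sets. -/

/-- Translates of a gated copy of a connected graph `H` whose `t`-neighbourhoods tile `ℤ^n` form
a `t`-PDDS[`H`]. -/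
theorem isPDDSOf_of_tiling {n t : ℕ} {W : Type*} {H : SimpleGraph W} (ht : 1 ≤ t)
    (hH : H.Connected) (f : W → Fin n → ℤ) (hf : Function.Injective f)
    (hadj : ∀ a b, H.Adj a b ↔ l1 (f a - f b) = 1)
    (hgate : ∀ v, ∃ p, ∀ w, l1 (v - f w) = l1 (v - f p) + l1 (f p - f w))
    (L : Set (Fin n → ℤ))
    (htile : ∀ v, ∃! c, c ∈ L ∧ ∃ w, l1 (v - c - f w) ≤ t) :
    IsPDDSOf (Lam n) t H {x | ∃ c ∈ L, ∃ w, x = c + f w} := by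
  set S : Set (Fin n → ℤ) := {x | ∃ c ∈ L, ∃ w, x = c + f w} with hS
  have hmem : ∀ c ∈ L, ∀ w, c + f w ∈ S := fun c hc w => ⟨c, hc, w, rfl⟩
  -- A neighbour `y` of the translate by `c` is within `1 ≤ t` of it and within `0` of its own
  -- translate; uniqueness in the tiling identifies the two.
  have hstep : ∀ c ∈ L, ∀ w, ∀ y ∈ S, (Lam n).Adj (c + f w) y → ∃ w', y = c + f w' := by
    rintro c hc w y ⟨c', hc', w', rfl⟩ h
    rw [lam_adj_iff] at h
    have h1 := (htile (c' + f w')).unique (y₁ := c) (y₂ := c')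
      ⟨hc, w, by
        rw [← l1_neg]
        have : -(c' + f w' - c - f w) = c + f w - (c' + f w') := by abel
        rw [this, h]
        exact ht⟩
      ⟨hc', w', by
        have : c' + f w' - c' - f w' = 0 := by abel
        rw [this, l1_eq_zero.2 rfl]
        exact Nat.zero_le _⟩
    exact ⟨w', by rw [h1]⟩
  have hreach : ∀ c ∈ L, ∀ x y : S, (∃ w, (x : Fin n → ℤ) = c + f w) →
      ((Lam n).induce S).Reachable x y → ∃ w, (y : Fin n → ℤ) = c + f w := by
    rintro c hc x y hx ⟨p⟩
    induction p with
    | nil => exact hx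
    | @cons x z y h p ih =>
      obtain ⟨w, hw⟩ := hx
      apply ih
      exact hstep c hc w z z.2 (hw ▸ h)
  let φ : ∀ c ∈ L, H →g (Lam n).induce S := fun c hc =>
    { toFun := fun w => ⟨c + f w, hmem c hc w⟩
      map_rel' := fun {a b} h => by
        change (Lam n).Adj (c + f a) (c + f b)
        rw [lam_adj_iff, add_sub_add_left_eq_sub]
        exact (hadj a b).1 h }
  obtain ⟨w₀⟩ := hH.nonempty
  let comp : ∀ c ∈ L, ((Lam n).induce S).ConnectedComponent := fun c hc =>
    ((Lam n).induce S).connectedComponentMk (φ c hc w₀)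
  have hsupp : ∀ c hc, ∀ x : S, x ∈ (comp c hc).supp ↔ ∃ w, (x : Fin n → ℤ) = c + f w := by
    intro c hc x
    rw [SimpleGraph.ConnectedComponent.mem_supp_iff, SimpleGraph.ConnectedComponent.eq]
    constructor
    · intro h
      exact hreach c hc _ x ⟨w₀, rfl⟩ h.symm
    · rintro ⟨w, hw⟩
      have : x = φ c hc w := Subtype.ext hw
      rw [this]
      exact (hH.preconnected w w₀).map (φ c hc)
  have hverts : ∀ c hc, verts (comp c hc) = Set.range fun w => c + f w := by
    intro c hc
    ext x
    constructor
    · rintro ⟨y, hy, rfl⟩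
      obtain ⟨w, hw⟩ := (hsupp c hc y).1 hy
      exact ⟨w, hw.symm⟩
    · rintro ⟨w, rfl⟩
      exact ⟨⟨c + f w, hmem c hc w⟩, (hsupp c hc _).2 ⟨w, rfl⟩, rfl⟩
  have hcomp : ∀ C : ((Lam n).induce S).ConnectedComponent, ∃ c hc, C = comp c hc := by
    intro C
    induction C using SimpleGraph.ConnectedComponent.ind with
    | h x =>
      obtain ⟨c, hc, w, hw⟩ := x.2
      exact ⟨c, hc, (SimpleGraph.ConnectedComponent.mem_supp_iff _ _).1
        ((hsupp c hc x).2 ⟨w, hw⟩)⟩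
  have hdist : ∀ c hc v, ∃ p, distTo (Lam n) v (verts (comp c hc)) = (l1 (v - c - f p) : ℕ∞) ∧
      ∀ w, l1 (v - c - f w) = l1 (v - c - f p) + l1 (f p - f w) := by
    intro c hc v
    obtain ⟨p, hp⟩ := hgate (v - c)
    refine ⟨p, ?_, hp⟩
    rw [hverts c hc, distTo, iInf_range]
    simp only [lam_edist, ← sub_sub]
    apply le_antisymm
    · exact iInf_le _ p
    · refine le_iInf fun w => ?_
      rw [hp w]
      exact_mod_cast Nat.le_add_right _ _
  have hle : ∀ c hc v, distTo (Lam n) v (verts (comp c hc)) ≤ t ↔ ∃ w, l1 (v - c - f w) ≤ t := by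
    intro c hc v
    obtain ⟨p, hp, hp'⟩ := hdist c hc v
    rw [hp]
    constructor
    · intro h
      exact ⟨p, by exact_mod_cast h⟩
    · rintro ⟨w, hw⟩
      have := hp' w
      exact_mod_cast (by omega : l1 (v - c - f p) ≤ t)
  refine ⟨fun v => ⟨?_, ?_⟩, ?_⟩
  · obtain ⟨c, ⟨hc, hw⟩, hu⟩ := htile v
    refine ⟨comp c hc, (hle c hc v).2 hw, ?_⟩
    intro C hC
    obtain ⟨c', hc', rfl⟩ := hcomp C
    obtain rfl := hu c' ⟨hc', (hle c' hc' v).1 hC⟩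
    rfl
  · intro C _
    obtain ⟨c, hc, rfl⟩ := hcomp C
    obtain ⟨p, hp, hp'⟩ := hdist c hc v
    refine ⟨c + f p, ⟨by rw [hverts c hc]; exact ⟨p, rfl⟩, by rw [hp, lam_edist, sub_sub]⟩, ?_⟩
    rintro y ⟨hy, hy'⟩
    rw [hverts c hc] at hy
    obtain ⟨w, rfl⟩ := hy
    simp only [hp, lam_edist, ← sub_sub] at hy'
    have h1 : l1 (v - c - f w) = l1 (v - c - f p) := by exact_mod_cast hy'
    have h2 := hp' w
    have h3 : l1 (f p - f w) = 0 := by omega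
    rw [sub_eq_zero.1 (l1_eq_zero.1 h3)]
  · intro C
    obtain ⟨c, hc, rfl⟩ := hcomp C
    let g : W → (comp c hc).supp := fun w => ⟨φ c hc w, (hsupp c hc _).2 ⟨w, rfl⟩⟩
    have hg : Function.Bijective g := by
      constructor
      · intro a b hab
        have h1 : c + f a = c + f b := congrArg (fun x => (x.1.1 : Fin n → ℤ)) hab
        exact hf (add_left_cancel h1)
      · rintro ⟨x, hx⟩
        obtain ⟨w, hw⟩ := (hsupp c hc x).1 hx
        exact ⟨w, Subtype.ext (Subtype.ext hw.symm)⟩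
    refine ⟨RelIso.symm ⟨Equiv.ofBijective g hg, ?_⟩⟩
    intro a b
    change (Lam n).Adj (c + f a) (c + f b) ↔ _
    rw [lam_adj_iff, add_sub_add_left_eq_sub]
    exact (hadj a b).symm

/-! ### Boxes and their neighbourhoods. -/

/-- The distance from an integer to the interval `{0, …, a - 1}`. -/
def gap (a : ℕ) (x : ℤ) : ℕ := (-x).toNat + (x - (a - 1)).toNat

/-- The distance from a point to the box `{0, …, a - 1} × {0, …, b - 1} × {0} × ⋯ × {0}`. -/
def boxGap {m : ℕ} (a b : ℕ) (x : Fin (m + 2) → ℤ) : ℕ :=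
  gap a (x 0) + gap b (x 1) + l1 fun i : Fin m => x i.succ.succ

/-- Take `p` to be `x` clamped to the interval: any way from `x` into the interval passes through
it. -/
lemma exists_clamp {a : ℕ} (ha : 1 ≤ a) (x : ℤ) :
    ∃ p : Fin a, ∀ w : Fin a,
      (x - (w : ℕ)).natAbs = gap a x + (((p : ℕ) : ℤ) - (w : ℕ)).natAbs := by
  refine ⟨⟨(min x (a - 1)).toNat, by omega⟩, fun w => ?_⟩
  have := w.2
  simp only [gap]
  omega

/-- The point of `ℤ^(m+2)` with first two coordinates `p` and the other ones zero. -/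
def boxPoint {a b : ℕ} (m : ℕ) (p : Fin a × Fin b) : Fin (m + 2) → ℤ :=
  Fin.cons ((p.1 : ℕ) : ℤ) (Fin.cons ((p.2 : ℕ) : ℤ) fun _ => 0)

lemma l1_succ_succ {m : ℕ} (x : Fin (m + 2) → ℤ) :
    l1 x = (x 0).natAbs + (x 1).natAbs + l1 fun i : Fin m => x i.succ.succ := by
  simp [l1, Fin.sum_univ_succ, add_assoc]

lemma l1_sub_boxPoint {a b m : ℕ} (x : Fin (m + 2) → ℤ) (p : Fin a × Fin b) :
    l1 (x - boxPoint m p) = (x 0 - (p.1 : ℕ)).natAbs + (x 1 - (p.2 : ℕ)).natAbs +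
      l1 fun i : Fin m => x i.succ.succ := by
  rw [l1_succ_succ]
  simp [boxPoint]

lemma l1_boxPoint_sub {a b m : ℕ} (p q : Fin a × Fin b) :
    l1 (boxPoint m p - boxPoint m q) =
      (((p.1 : ℕ) : ℤ) - (q.1 : ℕ)).natAbs + (((p.2 : ℕ) : ℤ) - (q.2 : ℕ)).natAbs := by
  rw [l1_sub_boxPoint]
  simp [boxPoint, l1]

lemma exists_boxPoint_gate {a b m : ℕ} (ha : 1 ≤ a) (hb : 1 ≤ b) (x : Fin (m + 2) → ℤ) :
    ∃ p : Fin a × Fin b, ∀ w : Fin a × Fin b, l1 (x - boxPoint m w) =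
      boxGap a b x + l1 (boxPoint m p - boxPoint m w) := by
  obtain ⟨p, hp⟩ := exists_clamp ha (x 0)
  obtain ⟨q, hq⟩ := exists_clamp hb (x 1)
  refine ⟨(p, q), fun w => ?_⟩
  rw [l1_sub_boxPoint, l1_boxPoint_sub, hp, hq, boxGap]
  ring

/-- Boxes whose `t`-neighbourhoods tile `ℤ^n` give a perfect distance-dominating set. -/
theorem exists_isPDDSOf_box {m a b t : ℕ} (ha : 1 ≤ a) (hb : 1 ≤ b) (ht : 1 ≤ t)
    (L : Set (Fin (m + 2) → ℤ)) (htile : ∀ v, ∃! c, c ∈ L ∧ boxGap a b (v - c) ≤ t) :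
    ∃ S : Set (Fin (m + 2) → ℤ), IsPDDSOf (Lam (m + 2)) t
      ((SimpleGraph.pathGraph a).boxProd (SimpleGraph.pathGraph b)) S := by
  have hconn : ∀ k : ℕ, 1 ≤ k → (SimpleGraph.pathGraph k).Connected := by
    intro k hk
    obtain ⟨k, rfl⟩ := Nat.exists_eq_add_of_le' hk
    exact SimpleGraph.pathGraph_connected k
  refine ⟨_, isPDDSOf_of_tiling ht ((hconn a ha).boxProd (hconn b hb)) (boxPoint m) ?_ ?_ ?_ L ?_⟩
  · intro p q h
    have h1 := congrFun h 0
    have h2 : ((p.2 : ℕ) : ℤ) = (q.2 : ℕ) := congrFun h 1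
    simp only [boxPoint, Fin.cons_zero] at h1
    exact Prod.ext (Fin.ext (by exact_mod_cast h1)) (Fin.ext (by exact_mod_cast h2))
  · intro p q
    rw [l1_boxPoint_sub, SimpleGraph.boxProd_adj, SimpleGraph.pathGraph_adj,
      SimpleGraph.pathGraph_adj, Fin.ext_iff, Fin.ext_iff]
    omega
  · intro v
    obtain ⟨p, hp⟩ := exists_boxPoint_gate ha hb v
    refine ⟨p, fun w => ?_⟩
    have h := hp p
    rw [sub_self, l1_eq_zero.2 rfl, add_zero] at h
    rw [hp w, h]
  · intro v
    have key : ∀ c, (c ∈ L ∧ ∃ w : Fin a × Fin b, l1 (v - c - boxPoint m w) ≤ t) ↔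
        (c ∈ L ∧ boxGap a b (v - c) ≤ t) := by
      intro c
      obtain ⟨p, hp⟩ := exists_boxPoint_gate ha hb (v - c)
      refine and_congr_right fun _ => ⟨?_, fun h => ⟨p, ?_⟩⟩
      · rintro ⟨w, hw⟩
        rw [hp w] at hw
        omega
      · rwa [hp p, sub_self, l1_eq_zero.2 rfl, add_zero]
    simpa only [key] using htile v

/-- The product of a path with a single vertex is that path. -/
def pathBoxOne (k : ℕ) :
    (SimpleGraph.pathGraph k).boxProd (SimpleGraph.pathGraph 1) ≃g SimpleGraph.pathGraph k where
  toEquiv := Equiv.prodUnique (Fin k) (Fin 1)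
  map_rel_iff' := by
    intro p q
    have h : ¬ (SimpleGraph.pathGraph 1).Adj p.2 q.2 := fun h => h.ne (Subsingleton.elim _ _)
    simp [SimpleGraph.boxProd_adj, eq_iff_true_of_subsingleton, h]

theorem exists_isPDDSOf_path {m k t : ℕ} (hk : 1 ≤ k) (ht : 1 ≤ t)
    (L : Set (Fin (m + 2) → ℤ)) (htile : ∀ v, ∃! c, c ∈ L ∧ boxGap k 1 (v - c) ≤ t) :
    ∃ S : Set (Fin (m + 2) → ℤ), IsPDDSOf (Lam (m + 2)) t (SimpleGraph.pathGraph k) S := by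
  obtain ⟨S, hS, hC⟩ := exists_isPDDSOf_box hk le_rfl ht L htile
  exact ⟨S, hS, fun C => (hC C).map fun e => e.trans (pathBoxOne k)⟩

/-! ### Tilings by subgroups. -/

/-- The neighbourhood is a transversal of the cosets of `L`: `hex` gives existence of the centre `v
- u`, `hsep` its uniqueness. -/
lemma existsUnique_translate {m a b t : ℕ} (L : AddSubgroup (Fin (m + 2) → ℤ))
    (hex : ∀ v, ∃ u, boxGap a b u ≤ t ∧ v - u ∈ L)
    (hsep : ∀ u w, boxGap a b u ≤ t → boxGap a b w ≤ t → u - w ∈ L → u = w) :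
    ∀ v, ∃! c, c ∈ (L : Set (Fin (m + 2) → ℤ)) ∧ boxGap a b (v - c) ≤ t := by
  intro v
  obtain ⟨u, hu, huL⟩ := hex v
  refine ⟨v - u, ⟨huL, by rwa [sub_sub_cancel]⟩, ?_⟩
  rintro c ⟨hc, hct⟩
  have h := hsep (v - c) u hct hu (by
    have : v - c - u = v - u - c := by abel
    rw [this]
    exact L.sub_mem huL hc)
  rw [← h, sub_sub_cancel]

/-- Summed over coordinates, this bounds differences within a neighbourhood by the diameter of the
box plus `2t`, which excludes nonzero lattice vectors. -/
lemma abs_sub_le_gap {a : ℕ} (ha : 1 ≤ a) (x y : ℤ) :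
    |x - y| ≤ (a : ℤ) - 1 + gap a x + gap a y := by
  rw [abs_le]
  simp only [gap]
  omega

lemma boxGap_fin_two {a b : ℕ} (x : Fin 2 → ℤ) : boxGap a b x = gap a (x 0) + gap b (x 1) := by
  simp [boxGap, l1]

/-! ### Planar tilings for every `t`. -/

/-- The subgroup of `ℤ²` generated by two vectors. -/
def lattice (e f : Fin 2 → ℤ) : AddSubgroup (Fin 2 → ℤ) where
  carrier := {c | ∃ p q : ℤ, c = p • e + q • f}
  zero_mem' := ⟨0, 0, by simp⟩
  add_mem' := by
    rintro _ _ ⟨p, q, rfl⟩ ⟨p', q', rfl⟩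
    exact ⟨p + p', q + q', by rw [add_smul, add_smul]; abel⟩
  neg_mem' := by
    rintro _ ⟨p, q, rfl⟩
    exact ⟨-p, -q, by rw [neg_smul, neg_smul]; abel⟩

lemma mem_lattice {e f c : Fin 2 → ℤ} : c ∈ lattice e f ↔
    ∃ p q : ℤ, c 0 = p * e 0 + q * f 0 ∧ c 1 = p * e 1 + q * f 1 := by
  refine exists_congr fun p => exists_congr fun q => ?_
  rw [funext_iff, Fin.forall_fin_two]
  simp

/-- The `t`-neighbourhoods of `2 × k` boxes tile the plane. -/
theorem two_box_tiling (t k : ℕ) (hk : 1 ≤ k) (v : Fin 2 → ℤ) :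
    ∃! c, c ∈ (lattice ![(t : ℤ) + 1, (k : ℤ) + t] ![2 * ((t : ℤ) + 1), 0] : Set (Fin 2 → ℤ)) ∧
      boxGap (m := 0) 2 k (v - c) ≤ t := by
  refine existsUnique_translate (m := 0) _ ?_ ?_ v
  · intro v
    simp only [boxGap_fin_two]
    set K : ℤ := (k : ℤ) + t with hK
    set T : ℤ := (t : ℤ) + 1 with hT
    have hs0 := Int.emod_nonneg (v 1) (show K ≠ 0 by omega)
    have hs1 := Int.emod_lt_of_pos (v 1) (show 0 < K by omega)
    have hs := Int.mul_ediv_add_emod (v 1) K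
    set p := v 1 / K
    set s := v 1 % K
    have key : ∀ z0 : ℤ, ∃ q z : ℤ, v 0 = p * T + q * (2 * T) + z ∧ z0 ≤ z ∧ z < z0 + 2 * T := by
      intro z0
      refine ⟨(v 0 - p * T - z0) / (2 * T), (v 0 - p * T - z0) % (2 * T) + z0, ?_, ?_, ?_⟩
      · have := Int.mul_ediv_add_emod (v 0 - p * T - z0) (2 * T)
        linarith
      · have := Int.emod_nonneg (v 0 - p * T - z0) (show 2 * T ≠ 0 by omega)
        omega
      · have := Int.emod_lt_of_pos (v 0 - p * T - z0) (show 0 < 2 * T by omega)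
        omega
    by_cases h1 : s ≤ k - 1
    · obtain ⟨q, z, hz, h2, h3⟩ := key (-t)
      refine ⟨![z, s], ?_, mem_lattice.2 ⟨p, q, ?_, ?_⟩⟩
      · simp [gap]
        omega
      · simp
        linarith
      · simp
        linarith
    -- With `j = s - (k - 1)`, this row is `j` above one layer of boxes and `t + 1 - j` below the
    -- next. Their neighbourhoods meet it in intervals of lengths `2 + 2(t - j)` and `2j`, filling
    -- the period `2T`; the shift by `T` puts them side by side.
    · obtain ⟨q, z, hz, h2, h3⟩ := key (-(t - (s - (k - 1))))
      by_cases h4 : z ≤ 1 + t - (s - (k - 1))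
      · refine ⟨![z, s], ?_, mem_lattice.2 ⟨p, q, ?_, ?_⟩⟩
        · simp [gap]
          omega
        · simp
          linarith
        · simp
          linarith
      · refine ⟨![z - T, s - K], ?_, mem_lattice.2 ⟨p + 1, q, ?_, ?_⟩⟩
        · simp [gap]
          omega
        · simp
          linarith
        · simp
          linarith
  · intro u w hu hw h
    rw [boxGap_fin_two] at hu hw
    obtain ⟨p, q, h0, h1⟩ := mem_lattice.1 h
    simp at h0 h1
    have h0' : u 0 - w 0 = (2 * q + p) * ((t : ℤ) + 1) := by linarith
    have g0 := abs_sub_le_gap one_le_two (u 0) (w 0)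
    have g1 := abs_sub_le_gap hk (u 1) (w 1)
    -- Two points of the neighbourhood are at most `k + 2t` apart. If `|p| ≥ 2`, the vertical
    -- difference is already `2(k + t)`; if `|p| = 1`, then `2q + p` is odd, so the distance is at
    -- least `(k + t) + (t + 1)`.
    have hp : p = 0 := by
      by_contra hp
      have hpos : (k : ℤ) + t ≤ |u 1 - w 1| := by
        rw [h1, abs_mul]
        have : 1 ≤ |p| := Int.one_le_abs hp
        rw [abs_of_nonneg (show (0 : ℤ) ≤ k + t by positivity)]
        nlinarith
      have h2 : 2 ≤ |p| → 2 * ((k : ℤ) + t) ≤ |u 1 - w 1| := by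
        intro h2
        rw [h1, abs_mul, abs_of_nonneg (show (0 : ℤ) ≤ k + t by positivity)]
        nlinarith
      have h3 : 2 * q + p ≠ 0 → (t : ℤ) + 1 ≤ |u 0 - w 0| := by
        intro h3
        rw [h0', abs_mul, abs_of_nonneg (show (0 : ℤ) ≤ t + 1 by positivity)]
        have : 1 ≤ |2 * q + p| := Int.one_le_abs h3
        nlinarith
      by_cases hp2 : 2 ≤ |p|
      · have := h2 hp2
        omega
      · have hp1 : 2 * q + p ≠ 0 := by
          rw [Int.abs_eq_natAbs] at hp2
          omega
        have := h3 hp1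
        omega
    subst hp
    have hq : q = 0 := by
      by_contra hq
      have h3 : 2 * ((t : ℤ) + 1) ≤ |u 0 - w 0| := by
        rw [h0', abs_mul, abs_of_nonneg (show (0 : ℤ) ≤ t + 1 by positivity)]
        have : 2 ≤ |2 * q + 0| := by
          rw [Int.abs_eq_natAbs]; omega
        nlinarith
      omega
    subst hq
    ext i
    fin_cases i
    · simpa [sub_eq_zero] using h0
    · simpa [sub_eq_zero] using h1

/-- The `t`-neighbourhoods of straight paths on `k` vertices tile the plane. -/
theorem path_tiling (t k : ℕ) (hk : 1 ≤ k) (ht : 1 ≤ t) (v : Fin 2 → ℤ) :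
    ∃! c, c ∈ (lattice ![(k : ℤ) + t, -(t : ℤ)] ![-1, 2 * (t : ℤ) + 1] : Set (Fin 2 → ℤ)) ∧
      boxGap (m := 0) k 1 (v - c) ≤ t := by
  refine existsUnique_translate (m := 0) _ ?_ ?_ v
  · intro v
    simp only [boxGap_fin_two]
    set M : ℤ := 2 * (t : ℤ) + 1 with hM
    -- The form `(x, y) ↦ y + M x` sends the generators to `N` and `0`, so the lattice is its kernel
    -- modulo `N`; `N` is also the size of the neighbourhood.
    set N : ℤ := k * M + 2 * t * t with hN
    have hNpos : 0 < N := by positivity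
    set W : ℤ := v 1 + M * v 0 with hW
    have hr0 := Int.emod_nonneg (W + t) hNpos.ne'
    have hr1 := Int.emod_lt_of_pos (W + t) hNpos
    have hr := Int.mul_ediv_add_emod (W + t) N
    set s := (W + t) / N
    set r := (W + t) % N
    set x := r / M with hx
    have hy0 := Int.emod_nonneg r (show M ≠ 0 by omega)
    have hy1 := Int.emod_lt_of_pos r (show 0 < M by omega)
    have hy := Int.mul_ediv_add_emod r M
    set y := r % M - t with hy'
    have hx0 : 0 ≤ x := Int.ediv_nonneg hr0 (by omega)
    have hv : v 1 + M * v 0 = N * s + M * x + y := by linarith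
    have fin : ∀ X Y s' : ℤ, gap k X + gap 1 Y ≤ t → v 1 + M * v 0 = N * s' + M * X + Y →
        ∃ u : Fin 2 → ℤ, gap k (u 0) + gap 1 (u 1) ≤ t ∧
          v - u ∈ lattice ![(k : ℤ) + t, -(t : ℤ)] ![-1, M] := by
      intro X Y s' hg h
      refine ⟨![X, Y], by simpa using hg,
        mem_lattice.2 ⟨s', s' * (k + t) - (v 0 - X), ?_, ?_⟩⟩
      · simp
      · simp
        have : v 1 - Y = N * s' + M * X - M * v 0 := by linarith
        rw [this, hN, hM]
        ring
    by_cases h1 : x ≤ k - 1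
    · refine fin x y s ?_ hv
      simp only [gap]
      omega
    · have h2 : x ≤ k - 1 + t := by
        by_contra h2
        have h3 : M * (k + t) ≤ M * x := mul_le_mul_of_nonneg_left (by omega) (by omega)
        nlinarith
      -- To the right of the path, points outside the right-hand triangle move into the left-hand
      -- one: those below by subtracting the first generator, those above by subtracting the sum of
      -- both.
      by_cases h3 : y < -(t - (x - (k - 1)))
      · refine fin (x - (k + t)) (y + t) (s + 1) ?_ ?_
        · simp only [gap]
          omega
        · rw [hv, hN, hM]; ring
      · by_cases h4 : t - (x - (k - 1)) < y
        · refine fin (x - (k + t) + 1) (y + t - M) (s + 1) ?_ ?_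
          · simp only [gap]
            omega
          · rw [hv, hN, hM]; ring
        · refine fin x y s ?_ hv
          simp only [gap]
          omega
  -- Points of the neighbourhood are at most `k - 1 + 2t` apart, and at most `2t` vertically; each
  -- position of `q` relative to `0` and `s` breaks one of these bounds.
  · have main : ∀ u w : Fin 2 → ℤ, gap k (u 0) + gap 1 (u 1) ≤ t → gap k (w 0) + gap 1 (w 1) ≤ t →
        ∀ s q : ℤ, 0 < s → u 0 - w 0 = s * (k + t) - q → u 1 - w 1 = -(s * t) + q * (2 * t + 1) →
        False := by
      intro u w hu hw s q hs h0 h1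
      simp only [gap] at hu hw
      have e1 : (k : ℤ) + t ≤ s * (k + t) := by nlinarith
      have e2 : (t : ℤ) ≤ s * t := by nlinarith
      rcases lt_trichotomy q 0 with hq | hq | hq
      · have : q * (2 * t + 1) ≤ -(2 * t + 1) := by nlinarith
        omega
      · subst hq
        omega
      · rcases lt_trichotomy q s with hqs | hqs | hqs
        · have : 2 * ((k : ℤ) + t - 1) + 1 ≤ s * (k + t) - q := by nlinarith
          omega
        · subst hqs
          have e3 : (k : ℤ) + t - 1 ≤ q * (k + t) - q := by nlinarith
          have e4 : (t : ℤ) + 1 ≤ -(q * t) + q * (2 * t + 1) := by nlinarith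
          omega
        · have : 2 * (t : ℤ) + 1 ≤ -(s * t) + q * (2 * t + 1) := by nlinarith
          omega
    intro u w hu hw h
    rw [boxGap_fin_two] at hu hw
    obtain ⟨s, q, h0, h1⟩ := mem_lattice.1 h
    simp at h0 h1
    rcases lt_trichotomy s 0 with hs | hs | hs
    · refine (main w u hw hu (-s) (-q) (by omega) ?_ ?_).elim <;> linarith
    · subst hs
      have hq : q = 0 := by
        simp only [gap] at hu hw
        by_contra hq
        have h3 : 2 * (t : ℤ) + 1 ≤ |u 1 - w 1| := by
          rw [h1, zero_mul, neg_zero, zero_add, abs_mul,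
            abs_of_nonneg (show (0 : ℤ) ≤ 2 * t + 1 by positivity)]
          have : 1 ≤ |q| := Int.one_le_abs hq
          nlinarith
        rw [Int.abs_eq_natAbs] at h3
        omega
      subst hq
      ext i
      fin_cases i
      · simpa [sub_eq_zero] using h0
      · simpa [sub_eq_zero] using h1
    · refine (main u w hu hw s q hs ?_ ?_).elim <;> linarith

/-! ### Tilings by kernels of linear forms. -/

/-- The integer vectors on which a linear form vanishes modulo `N`. -/
def modKer {n : ℕ} (a : Fin n → ℤ) (N : ℤ) : AddSubgroup (Fin n → ℤ) where
  carrier := {c | N ∣ a ⬝ᵥ c}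
  zero_mem' := by simp
  add_mem' := by
    intro c d hc hd
    change N ∣ a ⬝ᵥ (c + d)
    rw [dotProduct_add]
    exact dvd_add hc hd
  neg_mem' := by
    intro c hc
    change N ∣ a ⬝ᵥ (-c)
    rw [dotProduct_neg]
    exact (dvd_neg).2 hc

lemma sub_mem_modKer {n : ℕ} {a : Fin n → ℤ} {N : ℤ} {u v : Fin n → ℤ} :
    u - v ∈ modKer a N ↔ N ∣ a ⬝ᵥ u - a ⬝ᵥ v := by
  rw [← dotProduct_sub]
  rfl

lemma cons_cons_dotProduct {m : ℕ} (p q : ℤ) (a : Fin m → ℤ) (x : Fin (m + 2) → ℤ) :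
    (Fin.cons p (Fin.cons q a : Fin (m + 1) → ℤ) : Fin (m + 2) → ℤ) ⬝ᵥ x =
      p * x 0 + q * x 1 + a ⬝ᵥ fun i => x i.succ.succ := by
  simp [dotProduct, Fin.sum_univ_succ, add_assoc]

lemma cons_dotProduct {m : ℕ} (p : ℤ) (a : Fin m → ℤ) (x : Fin (m + 1) → ℤ) :
    (Fin.cons p a : Fin (m + 1) → ℤ) ⬝ᵥ x = p * x 0 + a ⬝ᵥ fun i => x i.succ := by
  simp [dotProduct, Fin.sum_univ_succ]

lemma boxGap_one_right {m a : ℕ} (x : Fin (m + 2) → ℤ) :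
    boxGap a 1 x = gap a (x 0) + l1 fun i : Fin (m + 1) => x i.succ := by
  have : gap 1 (x 1) = (x 1).natAbs := by simp only [gap]; omega
  rw [boxGap, this]
  simp [l1, Fin.sum_univ_succ, add_assoc]

lemma l1_le_one {n : ℕ} {x : Fin n → ℤ} (h : l1 x ≤ 1) :
    x = 0 ∨ (l1 x = 1 ∧ ∃ i, x = Pi.single i 1 ∨ x = Pi.single i (-1)) := by
  by_cases h0 : x = 0
  · exact Or.inl h0
  obtain ⟨i, hi⟩ := Function.ne_iff.1 h0
  have hi' : x i ≠ 0 := hi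
  have e1 : l1 x = (x i).natAbs + ∑ j ∈ Finset.univ.erase i, (x j).natAbs :=
    (Finset.add_sum_erase _ (fun j => (x j).natAbs) (Finset.mem_univ i)).symm
  have e2 : ∑ j ∈ Finset.univ.erase i, (x j).natAbs = 0 := by omega
  have e3 : ∀ j, j ≠ i → x j = 0 := by
    intro j hj
    have := (Finset.sum_eq_zero_iff.1 e2) j (by simp [hj])
    omega
  have e4 : x = Pi.single i (x i) := by
    ext j
    by_cases hj : j = i
    · subst hj; simp
    · simp [hj, e3 j hj]
  refine Or.inr ⟨by omega, i, ?_⟩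
  have e5 : x i = 1 ∨ x i = -1 := by omega
  rcases e5 with h5 | h5
  · left; rw [e4, h5]
  · right; rw [e4, h5]

lemma gap_eq_zero {a : ℕ} (x : ℤ) : gap a x = 0 ↔ 0 ≤ x ∧ x < a := by
  simp only [gap]; omega

lemma gap_le_one {a : ℕ} (ha : 1 ≤ a) (x : ℤ) : gap a x ≤ 1 ↔ -1 ≤ x ∧ x ≤ a := by
  simp only [gap]; omega

lemma eq_of_dvd_sub {N x y lo : ℤ} (h : N ∣ x - y) (hx : lo ≤ x) (hx' : x < lo + N)
    (hy : lo ≤ y) (hy' : y < lo + N) : x = y := by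
  have := Int.eq_zero_of_abs_lt_dvd h (by rw [abs_lt]; constructor <;> linarith)
  linarith

/-- The `1`-neighbourhoods of straight paths on `k` vertices tile `ℤ^(m+2)`. -/
theorem path_tiling_one (m k : ℕ) (hk : 1 ≤ k) (v : Fin (m + 2) → ℤ) :
    ∃! c, c ∈ (modKer (Fin.cons 1 fun i : Fin (m + 1) => 1 + (k : ℤ) * ((i : ℕ) + 1))
        (k * (2 * m + 3) + 2) : Set (Fin (m + 2) → ℤ)) ∧ boxGap k 1 (v - c) ≤ 1 := by
  -- On the neighbourhood the form takes each of `-1, …, N - 2` once modulo `N`: the path with its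
  -- two end neighbours gives `-1, …, k`; each positive direction gives the next block of `k`
  -- values; the negative directions, shifted by `N`, follow in reverse order.
  set a : Fin (m + 1) → ℤ := fun i => 1 + (k : ℤ) * ((i : ℕ) + 1) with ha
  set N : ℤ := k * (2 * m + 3) + 2 with hN
  have hkpos : (0 : ℤ) < k := by omega
  have hNpos : 0 < N := by positivity
  have hdot : ∀ x : Fin (m + 2) → ℤ,
      (Fin.cons 1 a : Fin (m + 2) → ℤ) ⬝ᵥ x = x 0 + a ⬝ᵥ fun i => x i.succ := by
    intro x
    rw [cons_dotProduct, one_mul]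
  refine existsUnique_translate _ ?_ ?_ v
  · intro v
    set w : ℤ := (Fin.cons 1 a : Fin (m + 2) → ℤ) ⬝ᵥ v with hw
    have hr0 := Int.emod_nonneg (w + 1) hNpos.ne'
    have hr1 := Int.emod_lt_of_pos (w + 1) hNpos
    have hr := Int.mul_ediv_add_emod (w + 1) N
    set s := (w + 1) / N
    set r := (w + 1) % N
    have fin : ∀ (j : ℤ) (y : Fin (m + 1) → ℤ), gap k j + l1 y ≤ 1 → N ∣ (r - 1) - (j + a ⬝ᵥ y) →
        ∃ u, boxGap k 1 u ≤ 1 ∧ v - u ∈ modKer (Fin.cons 1 a) N := by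
      intro j y hg hd
      refine ⟨Fin.cons j y, ?_, ?_⟩
      · rw [boxGap_one_right]
        simpa using hg
      · rw [sub_mem_modKer, ← hw, hdot]
        simp only [Fin.cons_zero, Fin.cons_succ]
        have : w - (j + a ⬝ᵥ y) = N * s + ((r - 1) - (j + a ⬝ᵥ y)) := by linarith
        rw [this]
        exact dvd_add (Dvd.intro _ rfl) hd
    by_cases h1 : r - 1 ≤ k
    · refine fin (r - 1) 0 ?_ (by simp)
      have : l1 (0 : Fin (m + 1) → ℤ) = 0 := l1_eq_zero.2 rfl
      rw [this, add_zero, gap_le_one hk]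
      omega
    · have hj0 := Int.emod_nonneg (r - 2) hkpos.ne'
      have hj1 := Int.emod_lt_of_pos (r - 2) hkpos
      have hj := Int.mul_ediv_add_emod (r - 2) k
      set q := (r - 2) / k
      set j := (r - 2) % k
      have hq1 : 1 ≤ q := by
        by_contra hq
        have : (k : ℤ) * q ≤ 0 := mul_nonpos_of_nonneg_of_nonpos hkpos.le (by omega)
        omega
      have hq2 : q ≤ 2 * m + 2 := by
        by_contra hq
        have : (k : ℤ) * (2 * m + 3) ≤ k * q := mul_le_mul_of_nonneg_left (by omega) hkpos.le
        omega
      have hg : gap k j = 0 := (gap_eq_zero j).2 ⟨hj0, hj1⟩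
      by_cases h2 : q ≤ m + 1
      · refine fin j (Pi.single ⟨(q - 1).toNat, by omega⟩ 1) (by rw [hg, l1_single]; rfl) ?_
        have : (((q - 1).toNat : ℕ) : ℤ) = q - 1 := by omega
        rw [dotProduct_single, ha]
        simp only [this]
        have : r - 1 - (j + (1 + (k : ℤ) * (q - 1 + 1)) * 1) = 0 := by linarith
        rw [this]
        exact dvd_zero _
      · refine fin j (Pi.single ⟨(2 * m + 2 - q).toNat, by omega⟩ (-1))
          (by rw [hg, l1_single]; rfl) ?_
        have : (((2 * m + 2 - q).toNat : ℕ) : ℤ) = 2 * m + 2 - q := by omega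
        rw [dotProduct_single, ha]
        simp only [this]
        refine ⟨1, ?_⟩
        rw [hN]
        linarith
  · have hnorm : ∀ u : Fin (m + 2) → ℤ, boxGap k 1 u ≤ 1 → ∃ r : ℤ, ∃ y : Fin (m + 1) → ℤ,
        (fun i : Fin (m + 1) => u i.succ) = y ∧
        N ∣ (Fin.cons 1 a : Fin (m + 2) → ℤ) ⬝ᵥ u - r ∧
        ((y = 0 ∧ r = u 0 ∧ -1 ≤ r ∧ r ≤ k) ∨
        (∃ i : Fin (m + 1), y = Pi.single i 1 ∧ r = u 0 + 1 + k * ((i : ℕ) + 1) ∧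
          0 ≤ u 0 ∧ u 0 < k) ∨
        (∃ i : Fin (m + 1), y = Pi.single i (-1) ∧ r = u 0 + 1 + k * (2 * m + 2 - (i : ℕ)) ∧
          0 ≤ u 0 ∧ u 0 < k)) := by
      intro u hu
      rw [boxGap_one_right] at hu
      rw [hdot]
      set y : Fin (m + 1) → ℤ := fun i => u i.succ with hy
      rcases l1_le_one (x := y) (by omega) with h | ⟨h, i, hi | hi⟩
      · refine ⟨u 0, y, rfl, by simp [h], Or.inl ⟨h, rfl, ?_⟩⟩
        exact (gap_le_one hk _).1 (by omega)
      · refine ⟨_, y, rfl, ?_, Or.inr (Or.inl ⟨i, hi, rfl, ?_⟩)⟩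
        · rw [hi, dotProduct_single, ha]
          refine ⟨0, by ring⟩
        · exact (gap_eq_zero _).1 (by omega)
      · refine ⟨_, y, rfl, ?_, Or.inr (Or.inr ⟨i, hi, rfl, ?_⟩)⟩
        · rw [hi, dotProduct_single, ha, hN]
          refine ⟨-1, by ring⟩
        · exact (gap_eq_zero _).1 (by omega)
    have hb : ∀ i : Fin (m + 1), (k : ℤ) ≤ k * ((i : ℕ) + 1) ∧
        (k : ℤ) * ((i : ℕ) + 1) ≤ k * (m + 1) ∧ (k : ℤ) * (m + 1) + k ≤ k * (2 * m + 2 - (i : ℕ)) ∧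
        (k : ℤ) * (2 * m + 2 - (i : ℕ)) + k ≤ k * (2 * m + 3) := by
      intro i
      have hi : ((i : ℕ) : ℤ) ≤ m := by have := i.2; omega
      have hi0 : (0 : ℤ) ≤ ((i : ℕ) : ℤ) := by positivity
      refine ⟨?_, ?_, ?_, ?_⟩ <;> nlinarith
    have heu : ∀ x y p q : ℤ, 0 ≤ x → x < k → 0 ≤ y → y < k → x + k * p = y + k * q →
        x = y ∧ p = q := by
      intro x y p q hx hx' hy hy' h
      have h1 : (k : ℤ) ∣ x - y := ⟨q - p, by linarith⟩
      have h2 := eq_of_dvd_sub (lo := 0) h1 hx (by omega) hy (by omega)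
      exact ⟨h2, mul_left_cancel₀ hkpos.ne' (by linarith)⟩
    have ext : ∀ u w : Fin (m + 2) → ℤ, u 0 = w 0 →
        (fun i : Fin (m + 1) => u i.succ) = (fun i : Fin (m + 1) => w i.succ) → u = w := by
      intro u w h0 h1
      ext i
      exact Fin.cases h0 (fun i => congrFun h1 i) i
    intro u w hu hw h
    rw [sub_mem_modKer] at h
    obtain ⟨r, y, hy, hr, h1⟩ := hnorm u hu
    obtain ⟨r', y', hy', hr', h1'⟩ := hnorm w hw
    have hdvd : N ∣ r - r' := by
      have : r - r' = ((Fin.cons 1 a : Fin (m + 2) → ℤ) ⬝ᵥ u - (Fin.cons 1 a : Fin (m + 2) → ℤ) ⬝ᵥ w)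
        - ((Fin.cons 1 a : Fin (m + 2) → ℤ) ⬝ᵥ u - r)
        + ((Fin.cons 1 a : Fin (m + 2) → ℤ) ⬝ᵥ w - r') := by ring
      rw [this]
      exact dvd_add (dvd_sub h hr) hr'
    have h0 := hb 0
    have hrange : ∀ (u : Fin (m + 2) → ℤ) (r : ℤ) (y : Fin (m + 1) → ℤ),
        ((y = 0 ∧ r = u 0 ∧ -1 ≤ r ∧ r ≤ k) ∨
        (∃ i : Fin (m + 1), y = Pi.single i 1 ∧ r = u 0 + 1 + k * ((i : ℕ) + 1) ∧
          0 ≤ u 0 ∧ u 0 < k) ∨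
        (∃ i : Fin (m + 1), y = Pi.single i (-1) ∧ r = u 0 + 1 + k * (2 * m + 2 - (i : ℕ)) ∧
          0 ≤ u 0 ∧ u 0 < k)) → -1 ≤ r ∧ r < -1 + N := by
      rintro u r y (⟨e, e0, l, l'⟩ | ⟨i, e, e0, l, l'⟩ | ⟨i, e, e0, l, l'⟩)
      · omega
      · have := hb i
        omega
      · have := hb i
        omega
    have hR := hrange u r y h1
    have hR' := hrange w r' y' h1'
    have hrr := eq_of_dvd_sub hdvd hR.1 hR.2 hR'.1 hR'.2
    clear hrange hdvd h hr hr' hR hR' hnorm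
    suffices hs : u 0 = w 0 ∧ y = y' from ext u w hs.1 (by rw [hy, hy', hs.2])
    clear hy hy'
    rcases h1 with ⟨e, e0, l, l'⟩ | ⟨i, e, e0, l, l'⟩ | ⟨i, e, e0, l, l'⟩ <;>
    rcases h1' with ⟨f, f0, g, g'⟩ | ⟨j, f, f0, g, g'⟩ | ⟨j, f, f0, g, g'⟩
    · exact ⟨by omega, by rw [e, f]⟩
    · have := hb j
      omega
    · have := hb j
      omega
    · have := hb i
      omega
    · obtain ⟨h2, h3⟩ := heu _ _ _ _ l l' g g'
        (show u 0 + k * ((i : ℕ) + 1) = w 0 + k * ((j : ℕ) + 1) by omega)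
      have : i = j := Fin.ext (by omega)
      exact ⟨h2, by rw [e, f, this]⟩
    · have := hb i
      have := hb j
      omega
    · have := hb i
      omega
    · have := hb i
      have := hb j
      omega
    · obtain ⟨h2, h3⟩ := heu _ _ _ _ l l' g g'
        (show u 0 + k * (2 * m + 2 - (i : ℕ)) = w 0 + k * (2 * m + 2 - (j : ℕ)) by omega)
      have : i = j := Fin.ext (by omega)
      exact ⟨h2, by rw [e, f, this]⟩

/-- The `1`-neighbourhoods of `2 × 2` squares tile `ℤ^(3r+2)`. -/
theorem square_tiling (r : ℕ) (v : Fin (3 * r + 2) → ℤ) :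
    ∃! c, c ∈ ((modKer (Fin.cons 2 (Fin.cons 3 fun i : Fin (3 * r) =>
          4 * (((i : ℕ) % 3 : ℕ) : ℤ)) : Fin (3 * r + 2) → ℤ) 12 ⊓
        modKer (Fin.cons 0 (Fin.cons 0 fun i : Fin (3 * r) =>
          1 + (((i : ℕ) / 3 : ℕ) : ℤ)) : Fin (3 * r + 2) → ℤ) (2 * r + 1) :
        AddSubgroup (Fin (3 * r + 2) → ℤ)) : Set (Fin (3 * r + 2) → ℤ)) ∧
      boxGap 2 2 (v - c) ≤ 1 := by
  -- The extra directions are grouped in threes. The form modulo `2r + 1` detects the group and the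
  -- sign, with `0` for the plane of the square; the form modulo `12` separates the `12` points left
  -- in each class.
  set a : Fin (3 * r) → ℤ := fun i => 4 * (((i : ℕ) % 3 : ℕ) : ℤ) with ha
  set b : Fin (3 * r) → ℤ := fun i => 1 + (((i : ℕ) / 3 : ℕ) : ℤ) with hb
  refine existsUnique_translate _ ?_ ?_ v
  · intro v
    simp only [AddSubgroup.mem_inf, sub_mem_modKer, cons_cons_dotProduct]
    set A : ℤ := 2 * v 0 + 3 * v 1 + a ⬝ᵥ fun i => v i.succ.succ
    set B : ℤ := 0 * v 0 + 0 * v 1 + b ⬝ᵥ fun i => v i.succ.succ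
    have fin : ∀ (x y : ℤ) (z : Fin (3 * r) → ℤ), gap 2 x + gap 2 y + l1 z ≤ 1 →
        12 ∣ A - (2 * x + 3 * y + a ⬝ᵥ z) → (2 * r + 1 : ℤ) ∣ B - b ⬝ᵥ z →
        ∃ u : Fin (3 * r + 2) → ℤ, boxGap 2 2 u ≤ 1 ∧
          12 ∣ A - (2 * u 0 + 3 * u 1 + a ⬝ᵥ fun i => u i.succ.succ) ∧
          (2 * r + 1 : ℤ) ∣ B - (0 * u 0 + 0 * u 1 + b ⬝ᵥ fun i => u i.succ.succ) := by
      intro x y z hg h1 h2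
      exact ⟨Fin.cons x (Fin.cons y z), hg, h1, by simpa using h2⟩
    have hr0 := Int.emod_nonneg (B + r) (show (2 * r + 1 : ℤ) ≠ 0 by omega)
    have hr1 := Int.emod_lt_of_pos (B + r) (show (0 : ℤ) < 2 * r + 1 by omega)
    have hr := Int.mul_ediv_add_emod (B + r) (2 * r + 1)
    set s := (B + r) / (2 * r + 1)
    set β := (B + r) % (2 * r + 1) - r with hβ
    have hB : ∀ z, b ⬝ᵥ z = β → (2 * r + 1 : ℤ) ∣ B - b ⬝ᵥ z := by
      intro z hz
      exact ⟨s, by linarith⟩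
    -- On the square `2x + 3y` takes the values `0, 2, 3, 5`, one in each class modulo `4`; `4σ`
    -- then fills out the residues modulo `12`.
    have hsq : ∀ A : ℤ, ∃ x y σ : ℤ, 0 ≤ x ∧ x ≤ 1 ∧ 0 ≤ y ∧ y ≤ 1 ∧ 0 ≤ σ ∧ σ ≤ 2 ∧
        12 ∣ A - (2 * x + 3 * y + 4 * σ) := by
      intro A
      have key : ∀ x y σ : ℤ, 0 ≤ x ∧ x ≤ 1 ∧ 0 ≤ y ∧ y ≤ 1 ∧ 0 ≤ σ ∧ σ ≤ 2 →
          12 ∣ A - (2 * x + 3 * y + 4 * σ) → ∃ x y σ : ℤ, 0 ≤ x ∧ x ≤ 1 ∧ 0 ≤ y ∧ y ≤ 1 ∧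
          0 ≤ σ ∧ σ ≤ 2 ∧ 12 ∣ A - (2 * x + 3 * y + 4 * σ) := by
        intro x y σ h h'
        exact ⟨x, y, σ, h.1, h.2.1, h.2.2.1, h.2.2.2.1, h.2.2.2.2.1, h.2.2.2.2.2, h'⟩
      have h4 : A % 4 = 0 ∨ A % 4 = 1 ∨ A % 4 = 2 ∨ A % 4 = 3 := by omega
      rcases h4 with h | h | h | h
      · exact key 0 0 (A / 4 % 3) (by omega) (by omega)
      · exact key 1 1 ((A - 5) / 4 % 3) (by omega) (by omega)
      · exact key 1 0 ((A - 2) / 4 % 3) (by omega) (by omega)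
      · exact key 0 1 ((A - 3) / 4 % 3) (by omega) (by omega)
    have hgap : ∀ x : ℤ, 0 ≤ x → x ≤ 1 → gap 2 x = 0 := by
      intro x h h'
      exact (gap_eq_zero x).2 ⟨h, by push_cast; omega⟩
    rcases lt_trichotomy β 0 with h | h | h
    -- The reflection `(x, y) ↦ (1 - x, 1 - y)` replaces `2x + 3y` by `5 - (2x + 3y)`, matching the
    -- sign of `-4σ`.
    · obtain ⟨x, y, σ, hx, hx', hy, hy', hσ, hσ', hA⟩ := hsq (-A + 5)
      have hlt : (3 * (-β - 1) + σ).toNat < 3 * r := by omega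
      refine fin (1 - x) (1 - y) (Pi.single ⟨(3 * (-β - 1) + σ).toNat, hlt⟩ (-1)) ?_ ?_ (hB _ ?_)
      · rw [hgap _ (by omega) (by omega), hgap _ (by omega) (by omega), l1_single]
        rfl
      · rw [dotProduct_single, ha]
        have : ((((3 * (-β - 1) + σ).toNat % 3 : ℕ)) : ℤ) = σ := by omega
        simp only [this]
        omega
      · rw [dotProduct_single, hb]
        have : ((((3 * (-β - 1) + σ).toNat / 3 : ℕ)) : ℤ) = -β - 1 := by omega
        simp only [this]
        ring
    · have key : ∀ x y : ℤ, gap 2 x + gap 2 y ≤ 1 → 12 ∣ A - (2 * x + 3 * y) →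
          ∃ u : Fin (3 * r + 2) → ℤ, boxGap 2 2 u ≤ 1 ∧
          12 ∣ A - (2 * u 0 + 3 * u 1 + a ⬝ᵥ fun i => u i.succ.succ) ∧
          (2 * r + 1 : ℤ) ∣ B - (0 * u 0 + 0 * u 1 + b ⬝ᵥ fun i => u i.succ.succ) := by
        intro x y hg hd
        refine fin x y 0 ?_ (by simpa using hd) (hB _ (by simp [h]))
        rwa [l1_eq_zero.2 rfl, add_zero]
      have h12 : ∃ e : ℤ, 0 ≤ e ∧ e < 12 ∧ 12 ∣ A - e := ⟨A % 12, by omega, by omega, by omega⟩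
      obtain ⟨e, he, he', hd⟩ := h12
      -- The square and its eight neighbours in the plane represent all residues modulo `12`.
      interval_cases e
      · exact key 0 0 (by decide) (by simpa using hd)
      · exact key (-1) 1 (by decide) (by simpa using hd)
      · exact key 1 0 (by decide) (by simpa using hd)
      · exact key 0 1 (by decide) (by simpa using hd)
      · exact key 2 0 (by decide) (by simpa using hd)
      · exact key 1 1 (by decide) (by simpa using hd)
      · exact key 0 2 (by decide) (by simpa using hd)
      · exact key 2 1 (by decide) (by simpa using hd)
      · exact key 1 2 (by decide) (by simpa using hd)
      · exact key 0 (-1) (by decide) (by omega)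
      · exact key (-1) 0 (by decide) (by omega)
      · exact key 1 (-1) (by decide) (by omega)
    · obtain ⟨x, y, σ, hx, hx', hy, hy', hσ, hσ', hA⟩ := hsq A
      have hlt : (3 * (β - 1) + σ).toNat < 3 * r := by omega
      refine fin x y (Pi.single ⟨(3 * (β - 1) + σ).toNat, hlt⟩ 1) ?_ ?_ (hB _ ?_)
      · rw [hgap _ hx hx', hgap _ hy hy', l1_single]
        rfl
      · rw [dotProduct_single, ha]
        have : ((((3 * (β - 1) + σ).toNat % 3 : ℕ)) : ℤ) = σ := by omega
        simp only [this]
        omega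
      · rw [dotProduct_single, hb]
        have : ((((3 * (β - 1) + σ).toNat / 3 : ℕ)) : ℤ) = β - 1 := by omega
        simp only [this]
        ring
  · have ext : ∀ u w : Fin (3 * r + 2) → ℤ, u 0 = w 0 → u 1 = w 1 →
        (fun i : Fin (3 * r) => u i.succ.succ) = (fun i : Fin (3 * r) => w i.succ.succ) →
        u = w := by
      intro u w h0 h1 h2
      ext i
      exact Fin.cases h0 (fun i => Fin.cases h1 (fun i => congrFun h2 i) i) i
    have hnorm : ∀ u : Fin (3 * r + 2) → ℤ, boxGap 2 2 u ≤ 1 →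
        ∃ (z : Fin (3 * r) → ℤ), (fun i : Fin (3 * r) => u i.succ.succ) = z ∧
        ((z = 0 ∧ a ⬝ᵥ z = 0 ∧ b ⬝ᵥ z = 0 ∧ gap 2 (u 0) + gap 2 (u 1) ≤ 1) ∨
        (∃ i : Fin (3 * r), z = Pi.single i 1 ∧ a ⬝ᵥ z = 4 * ((i : ℕ) % 3 : ℕ) ∧
          b ⬝ᵥ z = 1 + ((i : ℕ) / 3 : ℕ) ∧ (0 ≤ u 0 ∧ u 0 < 2) ∧ 0 ≤ u 1 ∧ u 1 < 2) ∨
        (∃ i : Fin (3 * r), z = Pi.single i (-1) ∧ a ⬝ᵥ z = -(4 * ((i : ℕ) % 3 : ℕ)) ∧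
          b ⬝ᵥ z = -(1 + ((i : ℕ) / 3 : ℕ)) ∧ (0 ≤ u 0 ∧ u 0 < 2) ∧ 0 ≤ u 1 ∧ u 1 < 2)) := by
      intro u hu
      rw [boxGap] at hu
      set z : Fin (3 * r) → ℤ := fun i => u i.succ.succ with hz
      refine ⟨z, rfl, ?_⟩
      rcases l1_le_one (x := z) (by omega) with h | ⟨h, i, hi | hi⟩
      · exact Or.inl ⟨h, by simp [h], by simp [h], by omega⟩
      · refine Or.inr (Or.inl ⟨i, hi, by simp [hi, ha], by simp [hi, hb], ?_, ?_⟩)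
        · have := (gap_eq_zero (a := 2) (u 0)).1 (by omega)
          omega
        · have := (gap_eq_zero (a := 2) (u 1)).1 (by omega)
          omega
      · refine Or.inr (Or.inr ⟨i, hi, by simp [hi, ha], by simp [hi, hb], ?_, ?_⟩)
        · have := (gap_eq_zero (a := 2) (u 0)).1 (by omega)
          omega
        · have := (gap_eq_zero (a := 2) (u 1)).1 (by omega)
          omega
    intro u w hu hw h
    simp only [AddSubgroup.mem_inf, sub_mem_modKer, cons_cons_dotProduct] at h
    obtain ⟨h1, h2⟩ := h
    obtain ⟨z, hz, hu'⟩ := hnorm u hu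
    obtain ⟨z', hz', hw'⟩ := hnorm w hw
    rw [hz, hz'] at h1 h2
    simp only [zero_mul, zero_add] at h2
    have hrange : ∀ (u : Fin (3 * r + 2) → ℤ) (z : Fin (3 * r) → ℤ),
        ((z = 0 ∧ a ⬝ᵥ z = 0 ∧ b ⬝ᵥ z = 0 ∧ gap 2 (u 0) + gap 2 (u 1) ≤ 1) ∨
        (∃ i : Fin (3 * r), z = Pi.single i 1 ∧ a ⬝ᵥ z = 4 * ((i : ℕ) % 3 : ℕ) ∧
          b ⬝ᵥ z = 1 + ((i : ℕ) / 3 : ℕ) ∧ (0 ≤ u 0 ∧ u 0 < 2) ∧ 0 ≤ u 1 ∧ u 1 < 2) ∨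
        (∃ i : Fin (3 * r), z = Pi.single i (-1) ∧ a ⬝ᵥ z = -(4 * ((i : ℕ) % 3 : ℕ)) ∧
          b ⬝ᵥ z = -(1 + ((i : ℕ) / 3 : ℕ)) ∧ (0 ≤ u 0 ∧ u 0 < 2) ∧ 0 ≤ u 1 ∧ u 1 < 2)) →
        -(r : ℤ) ≤ b ⬝ᵥ z ∧ b ⬝ᵥ z < -(r : ℤ) + (2 * r + 1) := by
      rintro u z (⟨-, -, h, -⟩ | ⟨i, -, -, h, -⟩ | ⟨i, -, -, h, -⟩)
      · omega
      · have := i.2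
        omega
      · have := i.2
        omega
    have hR := hrange u z hu'
    have hR' := hrange w z' hw'
    have hbb := eq_of_dvd_sub h2 hR.1 hR.2 hR'.1 hR'.2
    clear hrange h2 hnorm
    suffices hs : u 0 = w 0 ∧ u 1 = w 1 ∧ z = z' from
      ext u w hs.1 hs.2.1 (by rw [hz, hz', hs.2.2])
    clear hz hz' hR hR' hu hw
    rcases hu' with ⟨e, e0, e1, l⟩ | ⟨i, e, e0, e1, l, l'⟩ | ⟨i, e, e0, e1, l, l'⟩ <;>
    rcases hw' with ⟨f, f0, f1, g⟩ | ⟨j, f, f0, f1, g, g'⟩ | ⟨j, f, f0, f1, g, g'⟩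
    · rw [e0, f0] at h1
      simp only [gap] at l g
      refine ⟨?_, ?_, by rw [e, f]⟩ <;> omega
    · omega
    · omega
    · omega
    · rw [e0, f0] at h1
      have hij : i = j := Fin.ext (by omega)
      refine ⟨?_, ?_, by rw [e, f, hij]⟩ <;> omega
    · omega
    · omega
    · omega
    · rw [e0, f0] at h1
      have hij : i = j := Fin.ext (by omega)
      refine ⟨?_, ?_, by rw [e, f, hij]⟩ <;> omega

/-- The `2`-neighbourhoods of edges tile `ℤ³`. -/
theorem edge_tiling (v : Fin 3 → ℤ) :
    ∃! c, c ∈ (modKer ![1, 7, 11] 38 : Set (Fin 3 → ℤ)) ∧ boxGap (m := 1) 2 1 (v - c) ≤ 2 := by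
  have hdot : ∀ x : Fin 3 → ℤ, ![1, 7, 11] ⬝ᵥ x = x 0 + 7 * x 1 + 11 * x 2 := by
    intro x
    simp [dotProduct, Fin.sum_univ_three]
  have hgap : ∀ x : Fin 3 → ℤ, boxGap (m := 1) 2 1 x =
      gap 2 (x 0) + (x 1).natAbs + (x 2).natAbs := by
    intro x
    have : gap 1 (x 1) = (x 1).natAbs := by simp only [gap]; omega
    simp [boxGap, l1, this]
  refine existsUnique_translate (m := 1) _ ?_ ?_ v
  · intro v
    set A : ℤ := ![1, 7, 11] ⬝ᵥ v with hA
    -- Coordinates are shifted by `2` into `ℕ`, where truncated subtraction computes the gaps; `38`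
    -- is the size of the neighbourhood.
    have key : ∀ r < 38, ∃ x ∈ Finset.range 6, ∃ y ∈ Finset.range 5, ∃ z ∈ Finset.range 5,
        ((2 - x) + (x - 3) + ((2 - y) + (y - 2)) + ((2 - z) + (z - 2)) ≤ 2) ∧
        (x + 7 * y + 11 * z) % 38 = r := by
      decide +kernel
    obtain ⟨x, -, y, -, z, -, hg, hr⟩ := key (A % 38).toNat (by omega)
    refine ⟨![(x : ℤ) - 2, (y : ℤ) - 2, (z : ℤ) - 2], ?_, ?_⟩
    · rw [hgap]
      simp [gap]
      omega
    · rw [sub_mem_modKer, ← hA, hdot]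
      simp
      omega
  · intro u w hu hw h
    rw [sub_mem_modKer, hdot, hdot] at h
    rw [hgap] at hu hw
    have h0 := abs_sub_le_gap one_le_two (u 0) (w 0)
    -- The truncated `- 1` absorbs the length of the edge, leaving `2 + 2 = 4` for the two gaps.
    have key : ∀ p ∈ Finset.Icc (-5 : ℤ) 5, ∀ q ∈ Finset.Icc (-4 : ℤ) 4,
        ∀ r ∈ Finset.Icc (-4 : ℤ) 4, (p + 7 * q + 11 * r) % 38 = 0 →
        p.natAbs - 1 + q.natAbs + r.natAbs ≤ 4 → p = 0 ∧ q = 0 ∧ r = 0 := by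
      decide +kernel
    rw [Int.abs_eq_natAbs] at h0
    have g1 := Int.natAbs_sub_le (u 1) (w 1)
    have g2 := Int.natAbs_sub_le (u 2) (w 2)
    have hd : (u 0 - w 0 + 7 * (u 1 - w 1) + 11 * (u 2 - w 2)) % 38 = 0 := by omega
    have hn : (u 0 - w 0).natAbs - 1 + (u 1 - w 1).natAbs + (u 2 - w 2).natAbs ≤ 4 := by
      generalize (u 0 - w 0).natAbs = p at *
      generalize (u 1 - w 1).natAbs = q at *
      generalize (u 2 - w 2).natAbs = r at *
      generalize (u 1).natAbs = q₁ at *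
      generalize (w 1).natAbs = q₂ at *
      generalize (u 2).natAbs = r₁ at *
      generalize (w 2).natAbs = r₂ at *
      omega
    clear h0 g1 g2 hu hw h
    obtain ⟨h1, h2, h3⟩ := key (u 0 - w 0) (Finset.mem_Icc.2 (by omega))
      (u 1 - w 1) (Finset.mem_Icc.2 (by omega)) (u 2 - w 2) (Finset.mem_Icc.2 (by omega)) hd hn
    ext i
    fin_cases i
    · exact sub_eq_zero.1 h1
    · exact sub_eq_zero.1 h2
    · exact sub_eq_zero.1 h3

end PDDS

theorem theorem2 :
    -- (i)
    (∀ n k : ℕ, 2 ≤ n → 1 ≤ k →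
      ∃ S : Set (Fin n → ℤ), PDDS.IsPDDSOf (PDDS.Lam n) 1 (SimpleGraph.pathGraph k) S) ∧
    -- (ii)
    (∀ t k : ℕ, 1 ≤ t → 1 ≤ k →
      ∃ S : Set (Fin 2 → ℤ), PDDS.IsPDDSOf (PDDS.Lam 2) t (SimpleGraph.pathGraph k) S) ∧
    -- (iii)
    (∀ t k : ℕ, 1 ≤ t → 2 ≤ k →
      ∃ S : Set (Fin 2 → ℤ), PDDS.IsPDDSOf (PDDS.Lam 2) t
        ((SimpleGraph.pathGraph 2).boxProd (SimpleGraph.pathGraph k)) S) ∧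
    -- (iv)
    (∀ n r : ℕ, n = 3 * r + 2 →
      ∃ S : Set (Fin n → ℤ), PDDS.IsPDDSOf (PDDS.Lam n) 1
        ((SimpleGraph.pathGraph 2).boxProd (SimpleGraph.pathGraph 2)) S) ∧
    -- (v)
    (∃ S : Set (Fin 3 → ℤ), PDDS.IsPDDSOf (PDDS.Lam 3) 2 (SimpleGraph.pathGraph 2) S) := by
  refine ⟨?_, ?_, ?_, ?_, ?_⟩
  · intro n k hn hk
    obtain ⟨m, rfl⟩ := Nat.exists_eq_add_of_le' hn
    exact PDDS.exists_isPDDSOf_path hk le_rfl _ (PDDS.path_tiling_one m k hk)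
  · intro t k ht hk
    exact PDDS.exists_isPDDSOf_path (m := 0) hk ht _ (PDDS.path_tiling t k hk ht)
  · intro t k ht hk
    exact PDDS.exists_isPDDSOf_box (m := 0) one_le_two (by omega) ht _
      (PDDS.two_box_tiling t k (by omega))
  · rintro n r rfl
    exact PDDS.exists_isPDDSOf_box one_le_two one_le_two le_rfl _ (PDDS.square_tiling r)
  · exact PDDS.exists_isPDDSOf_path (m := 1) one_le_two one_le_two _ PDDS.edge_tiling
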